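/- Let $n\ge 0$ and let every nonempty subset (cell) $\sigma$ of $\{1,\dots,n\}$ carry a variable $p_\sigma$, its probability. The maximal random complex over $n$ points with independent cells takes as its values the simplicial complexes $\Delta$ on vertices from $\{1,\dots,n\}$ (the empty complex included): a cell can appear only if all its proper faces are present, and it then appears with probability $p_\sigma$, independently of the others. Thus $$p(\Delta)=\prod_{\sigma\in\Delta}p_\sigma\prod_{\sigma}(1-p_\sigma),$$ the second product being over the cells $\sigma\notin\Delta$ all of whose proper faces belong to $\Delta$. The expected zeroth Betti number is the polynomial $b_0^E=\sum_\Delta b_0(\Delta)\,p(\Delta)$ with integer coefficients, where $b_k(\Delta)=\dim H_k(\Delta;\mathbb Q)$. For a set $E$ of edges (two-element subsets of $\{1,\dots,n\}$), regarded as the complex of these edges and the vertices they cover, let $p_E$ be the product of all $p_e$, $e\in E$, and of all $p_v$, $v$ a vertex covered by $E$. Let $c(E)$ be the coefficient of the monomial $p_E$ in $b_0^E$, and put $c_1(E)=c(E)$ if $b_1(E)\ne0$ and $c_1(E)=0$ if $b_1(E)=0$. A simple cycle is a nonempty connected set of edges in which each covered vertex is covered by exactly two edges. We say that $E$ is built by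 simple cycles having 1-intersections if $E$ is the union of a nonempty family of simple cycles any two of which are linked by a chain of cycles of the family in which consecutive cycles have a common edge. **Theorem.** 1. After expansion, $$b_0^E=\sum_{i}p_i-\sum_{i<j}p_i\,p_j\,p_{ij}+\sum_{E}c_1(E)\,p_E ,$$ where the last sum is over all sets of edges $E$ built by simple cycles having 1-intersections, and $c(E)=c_1(E)$ for each of these $E$. In particular, every monomial not occurring in this formula has coefficient $0$ in $b_0^E$. 2. These coefficients are given by the following recursion: for every set $E$ of edges, $$\sum_{i=0}^{|E|}\ \sum_{E'\subseteq E,\ |E\setminus E'|=i}c_1(E')=b_1(E).$$ 3. If $|E|\ge2$ and $E$ has a 1-spike, that is, a nonempty connected set $S\subseteq E$ of edges none of which belongs to a simple cycle contained in $E$, then $c(E)=0$. 4. If $E$ is made of two 1-non-intersecting pieces, that is, $E=A\cup B$ with $A,B$ nonempty and without a common edge, and every simple cycle contained in $E$ is contained in $A$ or in $B$, then $c(E)=0$. -/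

import Mathlib

open Finset

namespace RandomComplex

noncomputable section

variable {V : Type*} [Fintype V] [LinearOrder V]

/-! ### Betti numbers of finite simplicial complexes

Simplicial complexes on a finite ordered vertex set `V` are Mathlib's `PreAbstractSimplicialComplex V`
(sets of nonempty finsets closed under passing to nonempty subsets; a point of `V` need not be a
vertex of the complex). -/

/-- The oriented incidence number of `τ` in `σ`: if `σ` has vertices `v₀ < ⋯ < vₘ` and
`τ = σ \ {vⱼ}`, it is `(-1)^j`; it is `0` if `τ` is not a facet of `σ`. -/
def incidence (τ σ : Finset V) : ℚ :=
  ∑ v ∈ σ, if σ.erase v = τ then (-1) ^ #{w ∈ σ | w < v} else 0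

/-- Rational chains on the faces of `K` that have exactly `m` vertices (dimension `m - 1`).
As the faces of `K` are nonempty, this is the zero space for `m = 0`. -/
abbrev Chains (K : PreAbstractSimplicialComplex V) (m : ℕ) : Type _ :=
  {σ : Finset V // σ ∈ K ∧ #σ = m} → ℚ

open Classical in
/-- The simplicial boundary map, from chains on faces with `m + 1` vertices (dimension `m`) to
chains on faces with `m` vertices. -/
def boundary (K : PreAbstractSimplicialComplex V) (m : ℕ) : Chains K (m + 1) →ₗ[ℚ] Chains K m :=
  Matrix.mulVecLin (Matrix.of fun τ σ => incidence τ.1 σ.1)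

/-- The `k`-th Betti number: the dimension of `H_k(K; ℚ)`, cycles modulo boundaries. -/
def betti (K : PreAbstractSimplicialComplex V) (k : ℕ) : ℕ :=
  Module.finrank ℚ
    (LinearMap.ker (boundary K k) ⧸
      (LinearMap.range (boundary K (k + 1))).submoduleOf (LinearMap.ker (boundary K k)))

/-! ### Random complexes with independent cells -/

instance : Finite (PreAbstractSimplicialComplex V) :=
  Finite.of_injective (fun K => K.faces) fun _ _ h => PreAbstractSimplicialComplex.ext h

instance : Fintype (PreAbstractSimplicialComplex V) := Fintype.ofFinite _

open Classical in
/-- The finite set of cells of `K`. -/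
def cells (K : PreAbstractSimplicialComplex V) : Finset (Finset V) := {σ | σ ∈ K}

open Classical in
/-- The probability that the random complex over `L` is exactly `K ≤ L`, as a polynomial in the cell
probabilities `p_σ = X σ`: a cell of `L` can only appear when all its proper faces are present, and
it then appears with probability `p_σ`, independently of the others. So a cell of `K` contributes
`p_σ`, a cell of `L` missing from `K` although all its proper faces are in `K` contributes
`1 - p_σ`, and a cell that lacks a proper face contributes nothing. -/
def prob (L K : PreAbstractSimplicialComplex V) : MvPolynomial (Finset V) ℤ :=
  ∏ σ ∈ cells L,
    if σ ∈ K then MvPolynomial.X σ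
    else if ∀ τ, τ.Nonempty → τ ⊂ σ → τ ∈ K then 1 - MvPolynomial.X σ
    else 1

open Classical in
/-- The expected `k`-th Betti number of the random complex over `L`: the sum over all subcomplexes
`K` of `b_k(K)` times the probability of `K`. The random complex over the vertex set `V` is maximal
when `L = ⊤`, the full simplex. -/
def expectedBetti (L : PreAbstractSimplicialComplex V) (k : ℕ) : MvPolynomial (Finset V) ℤ :=
  ∑ K : PreAbstractSimplicialComplex V with K ≤ L, (betti K k : MvPolynomial (Finset V) ℤ) * prob L K

/-- The exponent of the monomial `∏_{σ ∈ K} p_σ` that corresponds to the complex `K`. -/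
def cellExponent (K : PreAbstractSimplicialComplex V) : Finset V →₀ ℕ :=
  ∑ σ ∈ cells K, Finsupp.single σ 1

/-! ### One-dimensional complexes, given by their sets of edges -/

/-- All edges, i.e. all two-element sets of vertices. -/
def edges (V : Type*) [Fintype V] : Finset (Finset V) := powersetCard 2 univ

/-- The complex that consists of the given edges and the vertices covered by them. -/
def edgeComplex (E : Finset (Finset V)) : PreAbstractSimplicialComplex V where
  faces := {τ | τ.Nonempty ∧ ∃ e ∈ E, τ ⊆ e}
  isRelLowerSet_faces := by
    rintro τ ⟨hτ, e, he, hτe⟩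
    exact ⟨hτ, fun ρ hρ hne => ⟨hne, e, he, hρ.trans hτe⟩⟩

/-- A set of edges is connected: any two of its edges are joined by a chain of edges of the set in
which consecutive edges share a vertex. -/
def IsConnectedEdges (S : Finset (Finset V)) : Prop :=
  ∀ e ∈ S, ∀ f ∈ S,
    Relation.ReflTransGen (fun a b => a ∈ S ∧ b ∈ S ∧ (a ∩ b).Nonempty) e f

/-- A simple 1-cycle: a nonempty connected set of edges such that each covered vertex is covered by
exactly two of them. -/
def IsSimpleCycle (C : Finset (Finset V)) : Prop :=
  C ⊆ edges V ∧ C.Nonempty ∧ IsConnectedEdges C ∧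
    ∀ v, (∃ e ∈ C, v ∈ e) → #{e ∈ C | v ∈ e} = 2

/-- `E` is built by simple cycles having 1-intersections: it is the union of a nonempty family of
simple cycles, any two of which are linked by a chain of cycles of the family in which consecutive
cycles have an edge in common. -/
def IsBuiltByIntersectingCycles (E : Finset (Finset V)) : Prop :=
  ∃ F : Finset (Finset (Finset V)), F.Nonempty ∧ (∀ C ∈ F, IsSimpleCycle C) ∧ F.sup id = E ∧
    ∀ C ∈ F, ∀ D ∈ F,
      Relation.ReflTransGen (fun A B => A ∈ F ∧ B ∈ F ∧ (A ∩ B).Nonempty) C D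

/-- `S` is a 1-spike of `E`: a nonempty connected set of edges of `E` none of which belongs to a
simple cycle of `E`. -/
def IsSpike (E S : Finset (Finset V)) : Prop :=
  S ⊆ E ∧ S.Nonempty ∧ IsConnectedEdges S ∧ ∀ C ⊆ E, IsSimpleCycle C → Disjoint C S

/-- `E` is made of two 1-non-intersecting pieces: it is the union of two nonempty sets of edges
without a common edge, and each simple cycle of `E` lies in one of the two. -/
def IsMadeOfNonIntersectingPieces (E : Finset (Finset V)) : Prop :=
  ∃ A B : Finset (Finset V), A.Nonempty ∧ B.Nonempty ∧ Disjoint A B ∧ A ∪ B = E ∧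
    ∀ C ⊆ E, IsSimpleCycle C → C ⊆ A ∨ C ⊆ B

open Classical in
/-- The finite set of all edge sets built by simple cycles having 1-intersections. -/
def builtEdgeSets (V : Type*) [Fintype V] [LinearOrder V] : Finset (Finset (Finset V)) :=
  {E ∈ (edges V).powerset | IsBuiltByIntersectingCycles E}

/-- The coefficient, in the expected zeroth Betti number of the maximal random complex over `V`, of
the monomial of the edge set `E`, i.e. of the product of the `p_e`, `e ∈ E`, and the `p_v` for the
vertices `v` covered by `E`. -/
def edgeCoeff (E : Finset (Finset V)) : ℤ :=
  MvPolynomial.coeff (cellExponent (edgeComplex E)) (expectedBetti ⊤ 0)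

/-- `c₁(E)`: the coefficient of the monomial of `E`, replaced by `0` if the first Betti number of `E`
is zero. -/
def c₁ (E : Finset (Finset V)) : ℤ :=
  if betti (edgeComplex E) 1 = 0 then 0 else edgeCoeff E

end

end RandomComplex

/-!
The random complex is deterministic when all cell probabilities are `0` or `1`: it is then the
largest complex whose cells all have probability `1` (`eval_prob`). A polynomial of degree at most
one in each variable is determined by its values at such points, so an identity for the expected
Betti number `b₀ᴱ` amounts to an identity for the Betti numbers of all complexes
(`eq_of_eval_eq_of_mem_restrictDegree`).

The Euler relation for the 1-skeleton, `b₀(K) = #vertices - #edges + b₁(edges of K)`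
(`betti_zero_eq`), supplies this identity, once the last term is written as the sum, over the edge
sets `E` contained in `K`, of the Möbius inverse `cycleCoeff E` of the first Betti number. Hence
`cycleCoeff E` is the coefficient `c(E)` for every `E` that is not a single edge, and it is `c₁(E)`
for every `E` (`expectedBetti_zero_eq`, `edgeCoeff_eq_cycleCoeff`, `c₁_eq_cycleCoeff`). The
recursion for `c₁` is the definition of the Möbius inverse.

All vanishing statements come from one fact of graph theory: the rational cycle space of a graph is
spanned by 1-cycles carried by simple cycles, because an edge in the support of a 1-cycle is not a
bridge (`exists_isSimpleCycle_of_mem_cycleSpace`). So if every simple cycle of `A ⊔ B` lies in `A`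
or in `B`, then `b₁(E') = b₁(E' ∩ A) + b₁(E' ∩ B)` for all `E' ⊆ A ⊔ B`, and the Möbius inverse
vanishes at `A ⊔ B` (`cycleCoeff_union_eq_zero`). An edge outside all simple cycles is a piece of
its own, which settles spikes. If `cycleCoeff E ≠ 0`, the simple cycles of `E` that are linked to a
given one by common edges must cover `E`, since otherwise their union would split off as a piece
(`isBuiltByIntersectingCycles_of_cycleCoeff_ne_zero`).
-/

set_option linter.unusedSectionVars false

namespace RandomComplex

/-! ### Cycle spaces of edge sets -/

theorem exists_incidence_pair_eq {V : Type*} [LinearOrder V] {u v : V} (huv : u ≠ v) :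
    ∃ ε : ℚ, ε ≠ 0 ∧ ∀ w, incidence {w} {u, v} =
      ε * ((if w = v then 1 else 0) - if w = u then 1 else 0) := by
  have key : ∀ a b : V, a < b → ∀ w, incidence {w} {a, b} =
      (if w = b then 1 else 0) - if w = a then 1 else 0 := by
    intro a b hab w
    have h1 : ({a, b} : Finset V).erase a = {b} := by
      ext z; simp only [mem_erase, mem_insert, mem_singleton]; grind
    have h2 : ({a, b} : Finset V).erase b = {a} := by
      ext z; simp only [mem_erase, mem_insert, mem_singleton]; grind
    have h3 : ({w ∈ ({a, b} : Finset V) | w < a}) = ∅ := by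
      ext z; simp only [mem_filter, mem_insert, mem_singleton, notMem_empty, iff_false]
      rintro ⟨rfl | rfl, h⟩
      · exact lt_irrefl _ h
      · exact lt_asymm h hab
    have h4 : ({w ∈ ({a, b} : Finset V) | w < b}) = {a} := by
      ext z; simp only [mem_filter, mem_insert, mem_singleton]
      constructor
      · rintro ⟨rfl | rfl, h⟩
        · rfl
        · exact absurd h (lt_irrefl _)
      · rintro rfl; exact ⟨Or.inl rfl, hab⟩
    rw [incidence, sum_pair hab.ne, h1, h2, h3, h4]
    simp only [singleton_inj, card_empty, pow_zero, card_singleton, pow_one, eq_comm (a := w)]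
    split_ifs <;> ring
  rcases lt_or_gt_of_ne huv with h | h
  · exact ⟨1, one_ne_zero, fun w => by rw [key _ _ h, one_mul]⟩
  · refine ⟨-1, by norm_num, fun w => ?_⟩
    rw [pair_comm, key _ _ h]; ring

theorem pair_eq_pair_iff {V : Type*} [LinearOrder V] {a b c d : V} :
    ({a, b} : Finset V) = {c, d} ↔ s(a, b) = s(c, d) := by
  rw [← Finset.coe_inj]
  push_cast
  rw [Set.pair_eq_pair_iff, Sym2.eq_iff]

variable {V : Type*} [Fintype V] [LinearOrder V]

theorem exists_eq_pair_of_mem_edges {e : Finset V} (he : e ∈ edges V) :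
    ∃ u v, u ≠ v ∧ e = {u, v} := by
  rw [edges, mem_powersetCard] at he
  obtain ⟨u, v, h, rfl⟩ := card_eq_two.1 he.2
  exact ⟨u, v, h, rfl⟩

theorem pair_mem_edges {u v : V} (h : u ≠ v) : ({u, v} : Finset V) ∈ edges V := by
  rw [edges, mem_powersetCard]; exact ⟨subset_univ _, card_pair h⟩

/-- The boundary of a rational combination of edges of the full simplex on `V`, as a function on
the vertices. Only the values of `x` on two-element sets matter. -/
noncomputable def edgeBoundary : (Finset V → ℚ) →ₗ[ℚ] (V → ℚ) where
  toFun x v := ∑ e ∈ edges V, incidence {v} e * x e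
  map_add' x y := by
    ext v; simp only [Pi.add_apply, mul_add, sum_add_distrib]
  map_smul' c x := by
    ext v; simp only [Pi.smul_apply, smul_eq_mul, RingHom.id_apply, mul_sum]
    exact sum_congr rfl fun e _ => by ring

theorem edgeBoundary_single {e : Finset V} (he : e ∈ edges V) (c : ℚ) (v : V) :
    edgeBoundary (Pi.single e c) v = incidence {v} e * c := by
  simp [edgeBoundary, Pi.single_apply, he]

/-- The rational 1-cycles supported on the edge set `E`, as functions on all finsets of vertices
that vanish off `E`. -/
noncomputable def cycleSpace (E : Finset (Finset V)) : Submodule ℚ (Finset V → ℚ) where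
  carrier := {x | (∀ e ∉ E, x e = 0) ∧ edgeBoundary x = 0}
  zero_mem' := ⟨fun _ _ => rfl, map_zero _⟩
  add_mem' := by
    rintro x y ⟨hx, hx'⟩ ⟨hy, hy'⟩
    exact ⟨fun e he => by simp [hx e he, hy e he], by rw [map_add, hx', hy', add_zero]⟩
  smul_mem' := by
    rintro c x ⟨hx, hx'⟩
    exact ⟨fun e he => by simp [hx e he], by rw [map_smul, hx', smul_zero]⟩

theorem mem_cycleSpace {E : Finset (Finset V)} {x : Finset V → ℚ} :
    x ∈ cycleSpace E ↔ (∀ e ∉ E, x e = 0) ∧ edgeBoundary x = 0 := Iff.rfl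

theorem cycleSpace_mono {A B : Finset (Finset V)} (h : A ⊆ B) : cycleSpace A ≤ cycleSpace B :=
  fun _ hx => ⟨fun e he => hx.1 e fun h' => he (h h'), hx.2⟩

theorem cycleSpace_inf (A B : Finset (Finset V)) :
    cycleSpace A ⊓ cycleSpace B = cycleSpace (A ∩ B) := by
  ext x
  simp only [Submodule.mem_inf, mem_cycleSpace, mem_inter, not_and_or]
  grind

theorem cycleSpace_empty : cycleSpace (∅ : Finset (Finset V)) = ⊥ := by
  rw [eq_bot_iff]
  intro x hx
  exact funext fun e => hx.1 e (notMem_empty e)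

/-- The graph on `V` whose edges are the two-element sets in `D`. -/
def edgeGraph (D : Finset (Finset V)) : SimpleGraph V where
  Adj u v := u ≠ v ∧ {u, v} ∈ D
  symm := ⟨fun u v h => ⟨h.1.symm, by rw [pair_comm]; exact h.2⟩⟩
  loopless := ⟨fun u h => h.1 rfl⟩

/-! ### Simple cycles in the support of a 1-cycle -/

open Classical in
/-- The edges of a walk, as two-element sets of vertices. -/
noncomputable def walkEdges {G : SimpleGraph V} {u v : V} (p : G.Walk u v) : Finset (Finset V) :=
  {f | ∃ a b, s(a, b) ∈ p.edges ∧ f = {a, b}}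

theorem mem_walkEdges {G : SimpleGraph V} {u v : V} {p : G.Walk u v} {f : Finset V} :
    f ∈ walkEdges p ↔ ∃ a b, s(a, b) ∈ p.edges ∧ f = {a, b} := by
  simp [walkEdges]

theorem pair_mem_walkEdges {G : SimpleGraph V} {u v a b : V} {p : G.Walk u v} :
    {a, b} ∈ walkEdges p ↔ s(a, b) ∈ p.edges := by
  rw [mem_walkEdges]
  constructor
  · rintro ⟨c, d, h, h'⟩
    rwa [pair_eq_pair_iff.1 h']
  · exact fun h => ⟨a, b, h, rfl⟩

/-- A walk from `u` to `v` carries a chain with boundary `v - u`. -/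
theorem exists_edgeBoundary_eq_of_walk {G : SimpleGraph V} {u v : V} (p : G.Walk u v) :
    ∃ y : Finset V → ℚ, (∀ f ∉ walkEdges p, y f = 0) ∧
      ∀ w, edgeBoundary y w = (if w = v then 1 else 0) - if w = u then 1 else 0 := by
  induction p with
  | nil => exact ⟨0, fun _ _ => rfl, fun w => by simp⟩
  | @cons u u' v h p ih =>
    obtain ⟨y, hy, hyb⟩ := ih
    obtain ⟨ε, hε, hinc⟩ := exists_incidence_pair_eq h.ne
    refine ⟨y + Pi.single {u, u'} ε⁻¹, fun f hf => ?_, fun w => ?_⟩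
    · rw [Pi.add_apply, hy, Pi.single_eq_of_ne, add_zero]
      · rintro rfl
        exact hf (pair_mem_walkEdges.2 (by simp))
      · intro hf'
        obtain ⟨a, b, hab, rfl⟩ := mem_walkEdges.1 hf'
        exact hf (pair_mem_walkEdges.2 (by simp [hab]))
    · rw [map_add, Pi.add_apply, hyb, edgeBoundary_single (pair_mem_edges h.ne), hinc]
      field_simp
      ring

/-- Any edge of a walk is reached, through edges of an ambient set `C`, from any edge of `C` at the
start of the walk. -/
theorem reflTransGen_of_mem_walk {G : SimpleGraph V} {C : Finset (Finset V)} {u v : V}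
    (p : G.Walk u v) (hp : ∀ a b, s(a, b) ∈ p.edges → {a, b} ∈ C) {f : Finset V} (hf : f ∈ C)
    (hu : u ∈ f) {a b : V} (hab : s(a, b) ∈ p.edges) :
    Relation.ReflTransGen (fun a b => a ∈ C ∧ b ∈ C ∧ (a ∩ b).Nonempty) f {a, b} := by
  induction p generalizing f with
  | nil => simp at hab
  | @cons u u' v h p ih =>
    have hstep : Relation.ReflTransGen (fun a b => a ∈ C ∧ b ∈ C ∧ (a ∩ b).Nonempty) f {u, u'} :=
      .single ⟨hf, hp _ _ (by simp), u, by simp [hu]⟩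
    rw [SimpleGraph.Walk.edges_cons, List.mem_cons] at hab
    rcases hab with hab | hab
    · rwa [pair_eq_pair_iff.2 hab]
    · exact hstep.trans (ih (fun c d hcd => hp c d (by simp [hcd])) (hp u u' (by simp))
        (by simp) hab)

/-- The edges of a cycle of a graph form a simple cycle. -/
theorem isSimpleCycle_walkEdges {G : SimpleGraph V} {u : V} {p : G.Walk u u} (hp : p.IsCycle) :
    IsSimpleCycle (walkEdges p) := by
  have hadj : ∀ {a b}, s(a, b) ∈ p.edges → a ≠ b := fun h =>
    (p.adj_of_mem_edges h).ne
  refine ⟨?_, ?_, ?_, ?_⟩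
  · intro f hf
    obtain ⟨a, b, hab, rfl⟩ := mem_walkEdges.1 hf
    exact pair_mem_edges (hadj hab)
  · cases p with
    | nil => exact absurd hp (by simp)
    | cons h q => exact ⟨_, pair_mem_walkEdges.2 (SimpleGraph.Walk.edges_cons h q ▸ List.mem_cons_self)⟩
  · -- Rotate the cycle so that it starts at a vertex of the first of the two given edges.
    intro e he f hf
    obtain ⟨a, b, hab, rfl⟩ := mem_walkEdges.1 he
    obtain ⟨c, d, hcd, rfl⟩ := mem_walkEdges.1 hf
    have ha : a ∈ p.support := p.fst_mem_support_of_mem_edges hab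
    have hrot : ∀ e, e ∈ (p.rotate a ha).edges ↔ e ∈ p.edges := fun e =>
      (p.rotate_edges a ha).mem_iff
    exact reflTransGen_of_mem_walk (p.rotate a ha)
      (fun c d h => pair_mem_walkEdges.2 ((hrot _).1 h)) he (by simp) ((hrot _).2 hcd)
  · rintro v ⟨e, he, hv⟩
    obtain ⟨a, b, hab, rfl⟩ := mem_walkEdges.1 he
    have hvs : v ∈ p.support := by
      rcases mem_insert.1 hv with rfl | h
      · exact p.fst_mem_support_of_mem_edges hab
      · rw [mem_singleton.1 h]; exact p.snd_mem_support_of_mem_edges hab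
    rw [← hp.ncard_neighborSet_toSubgraph_eq_two hvs, ← Set.ncard_coe_finset]
    symm
    refine Set.ncard_congr (fun w _ => {v, w}) ?_ ?_ ?_
    · intro w hw
      rw [SimpleGraph.Subgraph.mem_neighborSet, ← SimpleGraph.Subgraph.mem_edgeSet,
        SimpleGraph.Walk.mem_edges_toSubgraph] at hw
      simp [pair_mem_walkEdges, hw]
    · intro w w' hw hw' h
      have := pair_eq_pair_iff.1 h
      simp only [Sym2.eq_iff] at this
      grind
    · intro f hf
      simp only [coe_filter, Set.mem_ofPred_eq] at hf
      obtain ⟨hf, hvf⟩ := hf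
      obtain ⟨c, d, hcd, rfl⟩ := mem_walkEdges.1 hf
      rcases mem_insert.1 hvf with rfl | h
      · refine ⟨d, ?_, rfl⟩
        rw [SimpleGraph.Subgraph.mem_neighborSet, ← SimpleGraph.Subgraph.mem_edgeSet,
          SimpleGraph.Walk.mem_edges_toSubgraph]
        exact hcd
      · obtain rfl := mem_singleton.1 h
        refine ⟨c, ?_, pair_comm _ _⟩
        rw [SimpleGraph.Subgraph.mem_neighborSet, ← SimpleGraph.Subgraph.mem_edgeSet,
          SimpleGraph.Walk.mem_edges_toSubgraph, Sym2.eq_swap]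
        exact hcd

/-- An edge in the support of a 1-cycle is not a bridge: otherwise summing the boundary over one
side of the bridge would give a nonzero multiple of the coefficient of that edge. -/
theorem reachable_deleteEdges_of_mem_cycleSpace {D : Finset (Finset V)}
    {x : Finset V → ℚ} (hx : x ∈ cycleSpace D) {u v : V} (huv : u ≠ v) (hxe : x {u, v} ≠ 0) :
    ((edgeGraph D).deleteEdges {s(u, v)}).Reachable u v := by
  classical
  by_contra hnr
  set H := (edgeGraph D).deleteEdges {s(u, v)} with hH
  let φ : V → ℚ := fun w => if H.Reachable u w then 1 else 0
  have hinc : ∀ {a b : V} {ε : ℚ}, (∀ w, incidence {w} {a, b} =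
      ε * ((if w = b then 1 else 0) - if w = a then 1 else 0)) →
      ∑ w, φ w * incidence {w} {a, b} = ε * (φ b - φ a) := by
    intro a b ε h
    simp only [h, mul_sub, sum_sub_distrib, mul_ite, mul_one, mul_zero, sum_ite_eq', mem_univ,
      if_true]
    ring
  have h0 : ∑ w, φ w * edgeBoundary x w = 0 := by simp [hx.2]
  have h1 : ∑ w, φ w * edgeBoundary x w =
      ∑ f ∈ edges V, (∑ w, φ w * incidence {w} f) * x f := by
    simp only [edgeBoundary, LinearMap.coe_mk, AddHom.coe_mk, mul_sum, sum_mul]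
    rw [sum_comm]
    exact sum_congr rfl fun f _ => sum_congr rfl fun w _ => by ring
  rw [h1, sum_eq_single_of_mem {u, v} (pair_mem_edges huv)] at h0
  · obtain ⟨ε, hε, h⟩ := exists_incidence_pair_eq huv
    rw [hinc h] at h0
    have hφu : φ u = 1 := if_pos (SimpleGraph.Reachable.refl u)
    have hφv : φ v = 0 := if_neg hnr
    rw [hφu, hφv] at h0
    simp [hε, hxe] at h0
  · intro f hf hne
    obtain ⟨a, b, hab, rfl⟩ := exists_eq_pair_of_mem_edges hf
    by_cases hD : {a, b} ∈ D
    · have hadj : H.Adj a b := by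
        rw [hH, SimpleGraph.deleteEdges_adj]
        exact ⟨⟨hab, hD⟩, fun h => hne (pair_eq_pair_iff.2 h)⟩
      have hφ : φ a = φ b := by
        have : H.Reachable u a ↔ H.Reachable u b :=
          ⟨fun h => h.trans hadj.reachable, fun h => h.trans hadj.symm.reachable⟩
        simp only [φ, this]
      obtain ⟨ε, hε, h⟩ := exists_incidence_pair_eq hab
      rw [hinc h, hφ, sub_self, mul_zero, zero_mul]
    · rw [hx.1 _ hD, mul_zero]

/-- Every edge in the support of a 1-cycle `x` lies on a simple cycle, and is in the support of a
1-cycle carried by that simple cycle. -/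
theorem exists_isSimpleCycle_of_mem_cycleSpace {D : Finset (Finset V)} (hD : D ⊆ edges V)
    {x : Finset V → ℚ} (hx : x ∈ cycleSpace D) {e : Finset V} (hxe : x e ≠ 0) :
    ∃ C ⊆ D, IsSimpleCycle C ∧ ∃ z ∈ cycleSpace C, z e ≠ 0 := by
  classical
  have heD : e ∈ D := by
    by_contra h; exact hxe (hx.1 e h)
  obtain ⟨u, v, huv, rfl⟩ := exists_eq_pair_of_mem_edges (hD heD)
  obtain ⟨q, hq⟩ := (reachable_deleteEdges_of_mem_cycleSpace hx huv hxe).symm.exists_isPath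
  set q' : (edgeGraph D).Walk v u := q.mapLe (SimpleGraph.deleteEdges_le _) with hq'
  have hq'p : q'.IsPath := (SimpleGraph.Walk.isPath_mapLe _).2 hq
  have hq'e : s(u, v) ∉ q'.edges := by
    rw [hq', SimpleGraph.Walk.edges_mapLe_eq_edges]
    intro h
    have := q.edges_subset_edgeSet h
    simp at this
  have hadj : (edgeGraph D).Adj u v := ⟨huv, heD⟩
  have hcyc : (SimpleGraph.Walk.cons hadj q').IsCycle :=
    (SimpleGraph.Walk.cons_isCycle_iff q' hadj).2 ⟨hq'p, hq'e⟩
  refine ⟨_, ?_, isSimpleCycle_walkEdges hcyc, ?_⟩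
  · intro f hf
    obtain ⟨a, b, hab, rfl⟩ := mem_walkEdges.1 hf
    exact ((SimpleGraph.Walk.cons hadj q').adj_of_mem_edges hab).2
  · obtain ⟨y, hy, hyb⟩ := exists_edgeBoundary_eq_of_walk q'
    obtain ⟨ε, hε, hinc⟩ := exists_incidence_pair_eq huv
    refine ⟨y + Pi.single {u, v} ε⁻¹, ⟨fun f hf => ?_, ?_⟩, ?_⟩
    · rw [Pi.add_apply, hy, Pi.single_eq_of_ne, add_zero]
      · rintro rfl
        exact hf (pair_mem_walkEdges.2 (by simp))
      · intro hf'
        obtain ⟨a, b, hab, rfl⟩ := mem_walkEdges.1 hf'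
        exact hf (pair_mem_walkEdges.2 (by simp [hab]))
    · ext w
      rw [map_add, Pi.add_apply, hyb, edgeBoundary_single (pair_mem_edges huv), hinc]
      simp only [Pi.zero_apply]
      field_simp
      ring
    · rw [Pi.add_apply, Pi.single_eq_same, hy _ (fun h => hq'e (pair_mem_walkEdges.1 h)), zero_add]
      exact inv_ne_zero hε

/-! ### Decomposition of cycle spaces -/

/-- If every simple cycle of `D` lies in `A` or in `B`, then every 1-cycle of `D` is the sum of one
on `A` and one on `B`: subtracting multiples of 1-cycles carried by simple cycles removes the
edges of the support one after the other. -/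
theorem cycleSpace_le_sup {A B D : Finset (Finset V)} (hD : D ⊆ edges V)
    (h : ∀ C ⊆ D, IsSimpleCycle C → C ⊆ A ∨ C ⊆ B) :
    cycleSpace D ≤ cycleSpace A ⊔ cycleSpace B := by
  induction D using Finset.strongInduction with
  | H D ih =>
    intro x hx
    by_cases hx0 : x = 0
    · rw [hx0]; exact zero_mem _
    obtain ⟨e, he⟩ := Function.ne_iff.1 hx0
    obtain ⟨C, hCD, hC, z, hz, hze⟩ := exists_isSimpleCycle_of_mem_cycleSpace hD hx he
    have heD : e ∈ D := by
      by_contra h'; exact he (hx.1 e h')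
    have hzD := cycleSpace_mono hCD hz
    have hzAB : z ∈ cycleSpace A ⊔ cycleSpace B := by
      rcases h C hCD hC with h' | h'
      · exact Submodule.mem_sup_left (cycleSpace_mono h' hz)
      · exact Submodule.mem_sup_right (cycleSpace_mono h' hz)
    have hsub : x - (x e / z e) • z ∈ cycleSpace (D.erase e) := by
      have hmem := sub_mem hx (Submodule.smul_mem _ (x e / z e) hzD)
      refine ⟨fun f hf => ?_, hmem.2⟩
      by_cases hfe : f = e
      · subst hfe
        simp [hze]
      · exact hmem.1 f fun hfD => hf (mem_erase.2 ⟨hfe, hfD⟩)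
    have hrec := ih (D.erase e) (erase_ssubset heD) ((erase_subset _ _).trans hD)
      (fun C hC => h C (hC.trans (erase_subset _ _))) hsub
    rw [← sub_add_cancel x ((x e / z e) • z)]
    exact add_mem hrec (Submodule.smul_mem _ _ hzAB)

/-- The dimension of the cycle space of an edge set, its first Betti number. -/
noncomputable def cyclomatic (E : Finset (Finset V)) : ℕ := Module.finrank ℚ (cycleSpace E)

theorem cyclomatic_empty : cyclomatic (∅ : Finset (Finset V)) = 0 := by
  rw [cyclomatic, cycleSpace_empty, finrank_bot]

theorem cyclomatic_mono {A B : Finset (Finset V)} (h : A ⊆ B) : cyclomatic A ≤ cyclomatic B :=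
  Submodule.finrank_mono (cycleSpace_mono h)

theorem cyclomatic_union {A B : Finset (Finset V)} (hE : A ∪ B ⊆ edges V) (hAB : Disjoint A B)
    (h : ∀ C ⊆ A ∪ B, IsSimpleCycle C → C ⊆ A ∨ C ⊆ B) :
    cyclomatic (A ∪ B) = cyclomatic A + cyclomatic B := by
  have hsup : cycleSpace (A ∪ B) = cycleSpace A ⊔ cycleSpace B :=
    le_antisymm (cycleSpace_le_sup hE h)
      (sup_le (cycleSpace_mono subset_union_left) (cycleSpace_mono subset_union_right))
  have := Submodule.finrank_sup_add_finrank_inf_eq (cycleSpace A) (cycleSpace B)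
  rw [cycleSpace_inf, disjoint_iff_inter_eq_empty.1 hAB, cycleSpace_empty, finrank_bot,
    ← hsup, add_zero] at this
  exact this

theorem one_lt_card_of_isSimpleCycle {C : Finset (Finset V)} (hC : IsSimpleCycle C) :
    1 < #C := by
  obtain ⟨hE, ⟨e, he⟩, -, hdeg⟩ := hC
  obtain ⟨u, v, -, rfl⟩ := exists_eq_pair_of_mem_edges (hE he)
  have := hdeg u ⟨_, he, by simp⟩
  exact lt_of_lt_of_le (by omega) (this ▸ card_filter_le C _)

theorem cyclomatic_singleton {e : Finset V} (he : e ∈ edges V) : cyclomatic {e} = 0 := by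
  have hbot : cycleSpace {e} = ⊥ := by
    rw [eq_bot_iff]
    intro x hx
    by_contra hx0
    obtain ⟨f, hf⟩ := Function.ne_iff.1 (show x ≠ 0 from hx0)
    obtain ⟨C, hC, hC', -⟩ :=
      exists_isSimpleCycle_of_mem_cycleSpace (singleton_subset_iff.2 he) hx hf
    have := card_le_card hC
    have := one_lt_card_of_isSimpleCycle hC'
    rw [card_singleton] at *
    omega
  rw [cyclomatic, hbot, finrank_bot]

/-! ### Betti numbers in degrees zero and one -/

open Classical in
/-- The set of edges of a complex. -/
noncomputable def edgesOf (K : PreAbstractSimplicialComplex V) : Finset (Finset V) :=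
  {e ∈ edges V | e ∈ K}

theorem mem_edges {e : Finset V} : e ∈ edges V ↔ #e = 2 := by
  rw [edges, mem_powersetCard]; simp

theorem mem_edgesOf {K : PreAbstractSimplicialComplex V} {e : Finset V} :
    e ∈ edgesOf K ↔ e ∈ K ∧ #e = 2 := by
  classical
  rw [edgesOf, mem_filter, mem_edges, and_comm]

theorem mem_edgeComplex {E : Finset (Finset V)} {σ : Finset V} :
    σ ∈ edgeComplex E ↔ σ.Nonempty ∧ ∃ e ∈ E, σ ⊆ e := Iff.rfl

theorem mem_of_subset {K : PreAbstractSimplicialComplex V} {σ τ : Finset V} (hσ : σ ∈ K)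
    (hτ : τ ⊆ σ) (hne : τ.Nonempty) : τ ∈ K :=
  (K.isRelLowerSet_faces hσ).2 hτ hne

theorem edgesOf_edgeComplex {E : Finset (Finset V)} (hE : E ⊆ edges V) :
    edgesOf (edgeComplex E) = E := by
  ext e
  rw [mem_edgesOf, mem_edgeComplex]
  constructor
  · rintro ⟨⟨-, f, hf, hef⟩, he⟩
    rwa [eq_of_subset_of_card_le hef (by rw [he, mem_edges.1 (hE hf)])]
  · intro he
    have h2 := mem_edges.1 (hE he)
    exact ⟨⟨card_pos.1 (by omega), e, he, Subset.rfl⟩, h2⟩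

theorem edgeComplex_le_iff {E : Finset (Finset V)} (hE : E ⊆ edges V)
    {K : PreAbstractSimplicialComplex V} : edgeComplex E ≤ K ↔ E ⊆ edgesOf K := by
  constructor
  · intro h e he
    rw [← edgesOf_edgeComplex hE, mem_edgesOf] at he
    exact mem_edgesOf.2 ⟨h he.1, he.2⟩
  · rintro h σ ⟨hσ, e, he, hσe⟩
    exact mem_of_subset (mem_edgesOf.1 (h he)).1 hσe hσ

open Classical in
/-- Extension by zero, from chains on the edges of `K` to functions on all finsets. -/
noncomputable def extendEdgeChain (K : PreAbstractSimplicialComplex V) :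
    Chains K 2 →ₗ[ℚ] (Finset V → ℚ) where
  toFun x σ := if h : σ ∈ K ∧ #σ = 2 then x ⟨σ, h⟩ else 0
  map_add' x y := by ext σ; by_cases h : σ ∈ K ∧ #σ = 2 <;> simp [h]
  map_smul' c x := by ext σ; by_cases h : σ ∈ K ∧ #σ = 2 <;> simp [h]

theorem extendEdgeChain_apply {K : PreAbstractSimplicialComplex V} (x : Chains K 2)
    (σ : {σ : Finset V // σ ∈ K ∧ #σ = 2}) : extendEdgeChain K x σ = x σ :=
  dif_pos σ.2

theorem extendEdgeChain_of_notMem {K : PreAbstractSimplicialComplex V} (x : Chains K 2)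
    {σ : Finset V} (h : σ ∉ edgesOf K) : extendEdgeChain K x σ = 0 :=
  dif_neg fun h' => h (mem_edgesOf.2 h')

theorem edgeBoundary_extendEdgeChain {K : PreAbstractSimplicialComplex V} (x : Chains K 2)
    (v : V) (h : {v} ∈ K ∧ #{v} = 1) :
    edgeBoundary (extendEdgeChain K x) v = boundary K 1 x ⟨{v}, h⟩ := by
  classical
  simp only [boundary, Matrix.mulVecLin_apply, Matrix.mulVec, dotProduct, Matrix.of_apply]
  have h1 : edgeBoundary (extendEdgeChain K x) v =
      ∑ e ∈ edgesOf K, incidence {v} e * extendEdgeChain K x e := by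
    rw [edgeBoundary, LinearMap.coe_mk, AddHom.coe_mk]
    symm
    refine sum_subset (filter_subset _ _) fun e _ he => ?_
    rw [extendEdgeChain_of_notMem x he, mul_zero]
  rw [h1, sum_subtype (edgesOf K) (fun e => mem_edgesOf)
    (fun e => incidence {v} e * extendEdgeChain K x e)]
  exact sum_congr rfl fun σ _ => by rw [extendEdgeChain_apply]

theorem map_ker_boundary_one (K : PreAbstractSimplicialComplex V) :
    (LinearMap.ker (boundary K 1)).map (extendEdgeChain K) = cycleSpace (edgesOf K) := by
  ext y
  rw [Submodule.mem_map]
  constructor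
  · rintro ⟨x, hx, rfl⟩
    refine ⟨fun e he => extendEdgeChain_of_notMem x he, ?_⟩
    ext v
    by_cases hv : {v} ∈ K
    · rw [edgeBoundary_extendEdgeChain x v ⟨hv, card_singleton v⟩, LinearMap.mem_ker.1 hx]
      rfl
    · -- No edge of `K` contains a point that is not a vertex of `K`.
      rw [edgeBoundary, LinearMap.coe_mk, AddHom.coe_mk, Pi.zero_apply]
      refine sum_eq_zero fun e he => ?_
      by_cases heK : e ∈ K
      · have : incidence {v} e = 0 := by
          refine sum_eq_zero fun w hw => if_neg fun h => hv ?_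
          exact h ▸ mem_of_subset heK (erase_subset w e) (h ▸ singleton_nonempty v)
        rw [this, zero_mul]
      · rw [extendEdgeChain_of_notMem x fun h => heK (mem_edgesOf.1 h).1, mul_zero]
  · intro hy
    have hext : extendEdgeChain K (fun σ => y σ) = y := by
      ext σ
      by_cases h : σ ∈ edgesOf K
      · exact extendEdgeChain_apply _ ⟨σ, mem_edgesOf.1 h⟩
      · rw [extendEdgeChain_of_notMem _ h, hy.1 σ h]
    refine ⟨fun σ => y σ, ?_, hext⟩
    rw [LinearMap.mem_ker]
    ext ⟨τ, hτ⟩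
    obtain ⟨v, rfl⟩ := card_eq_one.1 hτ.2
    rw [← edgeBoundary_extendEdgeChain, hext, hy.2]
    rfl

theorem finrank_ker_boundary_one (K : PreAbstractSimplicialComplex V) :
    Module.finrank ℚ (LinearMap.ker (boundary K 1)) = cyclomatic (edgesOf K) := by
  have hinj : Function.Injective (extendEdgeChain K) := by
    intro x y h
    ext σ
    rw [← extendEdgeChain_apply x, h, extendEdgeChain_apply]
  rw [cyclomatic, ← map_ker_boundary_one]
  exact (Submodule.equivMapOfInjective _ hinj _).finrank_eq

theorem betti_one_edgeComplex {E : Finset (Finset V)} (hE : E ⊆ edges V) :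
    betti (edgeComplex E) 1 = cyclomatic E := by
  have hempty : IsEmpty {σ : Finset V // σ ∈ edgeComplex E ∧ #σ = 1 + 1 + 1} := by
    constructor
    rintro ⟨σ, ⟨-, e, he, hσ⟩, h3⟩
    have := card_le_card hσ
    rw [mem_edges.1 (hE he)] at this
    omega
  have hbot : LinearMap.range (boundary (edgeComplex E) (1 + 1)) = ⊥ := by
    rw [eq_bot_iff]
    rintro _ ⟨x, rfl⟩
    rw [Subsingleton.elim x 0, map_zero]
    exact zero_mem _
  have h := Submodule.finrank_quotient_add_finrank
    ((LinearMap.range (boundary (edgeComplex E) (1 + 1))).submoduleOf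
      (LinearMap.ker (boundary (edgeComplex E) 1)))
  rw [finrank_ker_boundary_one, edgesOf_edgeComplex hE] at h
  rw [betti, ← h, hbot, Submodule.submoduleOf, Submodule.comap_bot, Submodule.ker_subtype,
    finrank_bot, add_zero]

open Classical in
/-- The Euler relation for the 1-skeleton. -/
theorem betti_zero_eq (K : PreAbstractSimplicialComplex V) :
    (betti K 0 : ℤ) = #{v : V | {v} ∈ K} - #(edgesOf K) + cyclomatic (edgesOf K) := by
  have hempty : IsEmpty {σ : Finset V // σ ∈ K ∧ #σ = 0} :=
    ⟨fun ⟨σ, hσ, h⟩ => (K.isRelLowerSet_faces hσ).1.ne_empty (card_eq_zero.1 h)⟩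
  have hker : LinearMap.ker (boundary K 0) = ⊤ := by
    rw [eq_top_iff]
    intro x _
    exact LinearMap.mem_ker.2 (Subsingleton.elim _ _)
  have hV : Module.finrank ℚ (Chains K 1) = #{v : V | {v} ∈ K} := by
    rw [Module.finrank_fintype_fun_eq_card, Fintype.card_subtype]
    symm
    refine card_bij (fun v _ => {v}) (by simp) (by simp) ?_
    intro σ hσ
    obtain ⟨hσ, h1⟩ := (mem_filter.1 hσ).2
    obtain ⟨v, rfl⟩ := card_eq_one.1 h1
    exact ⟨v, by simpa using hσ, rfl⟩
  have hE : Module.finrank ℚ (Chains K (1 + 1)) = #(edgesOf K) := by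
    rw [Module.finrank_fintype_fun_eq_card, Fintype.card_subtype]
    congr 1
    ext e
    simp [mem_edgesOf]
  have h1 := LinearMap.finrank_range_add_finrank_ker (boundary K 1)
  rw [finrank_ker_boundary_one, hE] at h1
  have h2 := Submodule.finrank_quotient_add_finrank
    ((LinearMap.range (boundary K (0 + 1))).submoduleOf (LinearMap.ker (boundary K 0)))
  have h3 : Module.finrank ℚ ((LinearMap.range (boundary K (0 + 1))).submoduleOf
      (LinearMap.ker (boundary K 0))) = Module.finrank ℚ (LinearMap.range (boundary K 1)) :=
    (Submodule.submoduleOfEquivOfLe (by rw [hker]; exact le_top)).finrank_eq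
  have h4 : Module.finrank ℚ (LinearMap.ker (boundary K 0)) = #{v : V | {v} ∈ K} := by
    rw [hker, finrank_top, hV]
  rw [h3, h4] at h2
  rw [betti]
  omega

/-! ### Möbius inversion of the first Betti number over edge sets -/

/-- The Möbius inverse of `cyclomatic` on the Boolean lattice of edge sets, defined by the
recursion that `sum_powerset_cycleCoeff` states. -/
noncomputable def cycleCoeff (E : Finset (Finset V)) : ℤ :=
  cyclomatic E - ∑ E' ∈ E.ssubsets.attach, cycleCoeff E'.1
termination_by #E
decreasing_by exact card_lt_card (mem_ssubsets.1 E'.2)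

theorem sum_powerset_cycleCoeff (E : Finset (Finset V)) :
    ∑ E' ∈ E.powerset, cycleCoeff E' = cyclomatic E := by
  rw [← add_sum_erase _ _ (mem_powerset_self E), cycleCoeff, ← ssubsets,
    sum_attach E.ssubsets (fun E' => cycleCoeff E')]
  ring

theorem cycleCoeff_eq_zero_of_cyclomatic {E : Finset (Finset V)} (h : cyclomatic E = 0) :
    cycleCoeff E = 0 := by
  induction E using Finset.strongInduction with
  | H E ih =>
    have := sum_powerset_cycleCoeff E
    rw [h, ← add_sum_erase _ _ (mem_powerset_self E), ← ssubsets, sum_eq_zero, add_zero] at this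
    · exact_mod_cast this
    · intro E' hE'
      have hss := mem_ssubsets.1 hE'
      exact ih E' hss (Nat.le_zero.1 (h ▸ cyclomatic_mono hss.subset))

/-- If every simple cycle lies in one of two pieces, the first Betti number is additive over the
pieces, for all subsets as well; so its Möbius inverse vanishes on sets that meet both pieces. -/
theorem cycleCoeff_union_eq_zero {A B : Finset (Finset V)} (hE : A ∪ B ⊆ edges V)
    (hA : A.Nonempty) (hB : B.Nonempty) (hAB : Disjoint A B)
    (h : ∀ C ⊆ A ∪ B, IsSimpleCycle C → C ⊆ A ∨ C ⊆ B) :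
    cycleCoeff (A ∪ B) = 0 := by
  induction hn : #(A ∪ B) using Nat.strong_induction_on generalizing A B with
  | _ n ih =>
    have hnot : A ∪ B ∉ A.powerset ∪ B.powerset := by
      rw [mem_union, mem_powerset, mem_powerset]
      rintro (h' | h')
      · exact hB.ne_empty (disjoint_self_iff_empty _ |>.1
          (hAB.mono_left (subset_union_right.trans h')))
      · exact hA.ne_empty (disjoint_self_iff_empty _ |>.1
          (hAB.mono_right (subset_union_left.trans h')))
    have hinter : A.powerset ∩ B.powerset = {∅} := by
      ext E'
      rw [mem_inter, mem_powerset, mem_powerset, ← subset_inter_iff,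
        disjoint_iff_inter_eq_empty.1 hAB, subset_empty, mem_singleton]
    have hsum : ∑ E' ∈ (A ∪ B).powerset, cycleCoeff E' =
        cycleCoeff (A ∪ B) + ∑ E' ∈ A.powerset ∪ B.powerset, cycleCoeff E' := by
      rw [← sum_insert hnot]
      symm
      refine sum_subset ?_ ?_
      · intro E' hE'
        rw [mem_insert, mem_union, mem_powerset, mem_powerset] at hE'
        rw [mem_powerset]
        rcases hE' with rfl | h' | h'
        · rfl
        · exact h'.trans subset_union_left
        · exact h'.trans subset_union_right
      · intro E' hE' hE''
        rw [mem_insert, mem_union, mem_powerset, mem_powerset, not_or, not_or] at hE''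
        rw [mem_powerset] at hE'
        obtain ⟨hne, hnA, hnB⟩ := hE''
        have hU : E' ∩ A ∪ E' ∩ B = E' := by
          rw [← inter_union_distrib_left, inter_eq_left.2 hE']
        rw [← hU]
        refine ih _ ?_ ?_ ?_ ?_ ?_ ?_ rfl
        · rw [hU, ← hn]
          exact card_lt_card (hE'.ssubset_of_ne hne)
        · rw [hU]; exact hE'.trans hE
        · rw [nonempty_iff_ne_empty]
          intro h0
          rw [h0, empty_union] at hU
          exact hnB (inter_eq_left.1 hU)
        · rw [nonempty_iff_ne_empty]
          intro h0
          rw [h0, union_empty] at hU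
          exact hnA (inter_eq_left.1 hU)
        · exact hAB.mono inter_subset_right inter_subset_right
        · intro C hC hC'
          rw [hU] at hC
          exact (h C (hC.trans hE') hC').imp (subset_inter hC) (subset_inter hC)
    have hui := sum_union_inter (s₁ := A.powerset) (s₂ := B.powerset) (f := cycleCoeff)
    rw [hinter, sum_singleton, cycleCoeff_eq_zero_of_cyclomatic cyclomatic_empty,
      sum_powerset_cycleCoeff, sum_powerset_cycleCoeff, add_zero] at hui
    rw [sum_powerset_cycleCoeff, cyclomatic_union hE hAB h, hui] at hsum
    push_cast at hsum
    linarith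

theorem cycleCoeff_eq_zero_of_isMadeOfNonIntersectingPieces {E : Finset (Finset V)}
    (hE : E ⊆ edges V) (h : IsMadeOfNonIntersectingPieces E) : cycleCoeff E = 0 := by
  obtain ⟨A, B, hA, hB, hAB, rfl, h⟩ := h
  exact cycleCoeff_union_eq_zero hE hA hB hAB h

/-- A single edge of the spike and the remaining edges are two non-intersecting pieces. -/
theorem isMadeOfNonIntersectingPieces_of_isSpike {E S : Finset (Finset V)} (hE : 2 ≤ #E)
    (hS : IsSpike E S) : IsMadeOfNonIntersectingPieces E := by
  obtain ⟨hSE, ⟨e, he⟩, -, hcyc⟩ := hS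
  refine ⟨{e}, E.erase e, singleton_nonempty e, ?_, ?_, ?_, ?_⟩
  · rw [← card_pos, card_erase_of_mem (hSE he)]; omega
  · rw [disjoint_singleton_left]; exact notMem_erase e E
  · rw [← insert_eq, insert_erase (hSE he)]
  · intro C hC hC'
    exact Or.inr (subset_erase.2 ⟨hC, fun h => disjoint_left.1 (hcyc C hC hC') h he⟩)

theorem exists_isSimpleCycle_of_cyclomatic_ne_zero {E : Finset (Finset V)} (hE : E ⊆ edges V)
    (h : cyclomatic E ≠ 0) : ∃ C ⊆ E, IsSimpleCycle C := by
  have hne : cycleSpace E ≠ ⊥ := fun h0 => h (by rw [cyclomatic, h0, finrank_bot])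
  obtain ⟨x, hx, hx0⟩ := Submodule.exists_mem_ne_zero_of_ne_bot hne
  obtain ⟨e, he⟩ := Function.ne_iff.1 hx0
  obtain ⟨C, hC, hC', -⟩ := exists_isSimpleCycle_of_mem_cycleSpace hE hx he
  exact ⟨C, hC, hC'⟩

/-- The simple cycles linked to a given one by chains with common edges cover `E`: otherwise their
union and its complement in `E` would be two non-intersecting pieces. -/
theorem isBuiltByIntersectingCycles_of_cycleCoeff_ne_zero {E : Finset (Finset V)}
    (hE : E ⊆ edges V) (h : cycleCoeff E ≠ 0) : IsBuiltByIntersectingCycles E := by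
  classical
  obtain ⟨C₀, hC₀E, hC₀⟩ := exists_isSimpleCycle_of_cyclomatic_ne_zero hE
    fun h0 => h (cycleCoeff_eq_zero_of_cyclomatic h0)
  let R : Finset (Finset V) → Finset (Finset V) → Prop := fun A B =>
    (A ⊆ E ∧ IsSimpleCycle A) ∧ (B ⊆ E ∧ IsSimpleCycle B) ∧ (A ∩ B).Nonempty
  let F : Finset (Finset (Finset V)) :=
    {C ∈ E.powerset | IsSimpleCycle C ∧ Relation.ReflTransGen R C₀ C}
  have hF : ∀ {C}, C ∈ F ↔ C ⊆ E ∧ IsSimpleCycle C ∧ Relation.ReflTransGen R C₀ C := by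
    intro C; simp [F]
  have hC₀F : C₀ ∈ F := hF.2 ⟨hC₀E, hC₀, .refl⟩
  have hFE : F.sup id ⊆ E := Finset.sup_le fun C hC => (hF.1 hC).1
  have hCF : ∀ {C}, C ∈ F → C ⊆ F.sup id := fun hC => le_sup (f := id) hC
  refine ⟨F, ⟨C₀, hC₀F⟩, fun C hC => (hF.1 hC).2.1, ?_, ?_⟩
  · by_contra hne
    refine h (cycleCoeff_eq_zero_of_isMadeOfNonIntersectingPieces hE
      ⟨F.sup id, E \ F.sup id, ?_, ?_, disjoint_sdiff, union_sdiff_of_subset hFE, ?_⟩)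
    · exact hC₀.2.1.mono (hCF hC₀F)
    · rw [sdiff_nonempty]
      exact fun h' => hne (hFE.antisymm h')
    · intro C hCE hC
      by_cases hCF' : C ∈ F
      · exact Or.inl (hCF hCF')
      · refine Or.inr (subset_sdiff.2 ⟨hCE, disjoint_left.2 fun e heC he => hCF' ?_⟩)
        obtain ⟨D, hD, heD⟩ := mem_sup.1 he
        obtain ⟨hDE, hD, hchain⟩ := hF.1 hD
        exact hF.2 ⟨hCE, hC, hchain.tail
          ⟨⟨hDE, hD⟩, ⟨hCE, hC⟩, e, mem_inter.2 ⟨heD, heC⟩⟩⟩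
  · have hto : ∀ C ∈ F, Relation.ReflTransGen
        (fun A B => A ∈ F ∧ B ∈ F ∧ (A ∩ B).Nonempty) C₀ C := by
      intro C hC
      have hchain := (hF.1 hC).2.2
      clear hC
      induction hchain with
      | refl => exact .refl
      | tail h₁ h₂ ih =>
        exact ih.tail ⟨hF.2 ⟨h₂.1.1, h₂.1.2, h₁⟩, hF.2 ⟨h₂.2.1.1, h₂.2.1.2, h₁.tail h₂⟩, h₂.2.2⟩
    intro C hC D hD
    refine Relation.ReflTransGen.trans ?_ (hto D hD)
    exact (Relation.reflTransGen_swap.2 (hto C hC)).lift id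
      fun A B h => ⟨h.2.1, h.1, by rw [inter_comm]; exact h.2.2⟩

theorem two_le_card_of_isBuiltByIntersectingCycles {E : Finset (Finset V)}
    (h : IsBuiltByIntersectingCycles E) : 2 ≤ #E := by
  obtain ⟨F, ⟨C, hC⟩, hF, rfl, -⟩ := h
  exact (one_lt_card_of_isSimpleCycle (hF C hC)).trans_le (card_le_card (le_sup (f := id) hC))

/-! ### The expected Betti number as a polynomial -/

theorem mem_cells {K : PreAbstractSimplicialComplex V} {σ : Finset V} : σ ∈ cells K ↔ σ ∈ K := by
  simp [cells]

open Classical in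
theorem cellExponent_apply (K : PreAbstractSimplicialComplex V) (σ : Finset V) :
    cellExponent K σ = if σ ∈ K then 1 else 0 := by
  rw [cellExponent, Finsupp.finsetSum_apply]
  simp [Finsupp.single_apply, mem_cells]

theorem cellExponent_injective :
    Function.Injective (cellExponent : PreAbstractSimplicialComplex V → Finset V →₀ ℕ) := by
  classical
  intro K L h
  refine SetLike.ext fun σ => ?_
  have := DFunLike.congr_fun h σ
  rw [cellExponent_apply, cellExponent_apply] at this
  by_cases h1 : σ ∈ K <;> by_cases h2 : σ ∈ L <;> simp_all

/-- The largest complex all of whose cells take the value `1` under `x`. -/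
def onesComplex (x : Finset V → ℤ) : PreAbstractSimplicialComplex V where
  faces := {σ | σ.Nonempty ∧ ∀ τ ⊆ σ, τ.Nonempty → x τ = 1}
  isRelLowerSet_faces := by
    rintro σ ⟨hσ, h⟩
    exact ⟨hσ, fun ρ hρ hne => ⟨hne, fun τ hτ => h τ (hτ.trans hρ)⟩⟩

theorem mem_onesComplex {x : Finset V → ℤ} {σ : Finset V} :
    σ ∈ onesComplex x ↔ σ.Nonempty ∧ ∀ τ ⊆ σ, τ.Nonempty → x τ = 1 := Iff.rfl

theorem mem_top_iff {σ : Finset V} :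
    σ ∈ (⊤ : PreAbstractSimplicialComplex V) ↔ σ.Nonempty := Iff.rfl

open Classical in
/-- With cell probabilities `0` and `1`, the random complex is deterministic. -/
theorem eval_prob {x : Finset V → ℤ} (hx : ∀ σ, x σ = 0 ∨ x σ = 1)
    (K : PreAbstractSimplicialComplex V) :
    MvPolynomial.eval x (prob ⊤ K) = if K = onesComplex x then 1 else 0 := by
  rw [prob, map_prod]
  split_ifs with hK
  · refine prod_eq_one fun σ hσ => ?_
    have hσ' := mem_top_iff.1 (mem_cells.1 hσ)
    by_cases h1 : σ ∈ K
    · rw [if_pos h1, MvPolynomial.eval_X]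
      rw [hK] at h1
      exact h1.2 σ Subset.rfl hσ'
    · rw [if_neg h1]
      split_ifs with h2
      · have : x σ = 0 := by
          refine (hx σ).resolve_right fun hxσ => h1 ?_
          rw [hK]
          refine ⟨hσ', fun τ hτ hne => ?_⟩
          rcases hτ.eq_or_ssubset with rfl | hss
          · exact hxσ
          · have := h2 τ hne hss
            rw [hK] at this
            exact this.2 τ Subset.rfl hne
        simp [this]
      · simp
  · by_cases hle : K ≤ onesComplex x
    · -- A minimal cell of `onesComplex x` that is missing from `K` gives a vanishing factor.
      have hex : ((cells (onesComplex x)).filter (· ∉ K)).Nonempty := by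
        by_contra hemp
        rw [not_nonempty_iff_eq_empty, filter_eq_empty_iff] at hemp
        refine hK (le_antisymm hle fun σ hσ => ?_)
        exact not_not.1 (hemp (mem_cells.2 hσ))
      obtain ⟨σ, hσ, hmin⟩ := exists_min_image _ card hex
      rw [mem_filter, mem_cells] at hσ
      obtain ⟨hσx, hσK⟩ := hσ
      refine prod_eq_zero (i := σ) (mem_cells.2 hσx.1) ?_
      rw [if_neg hσK, if_pos]
      · rw [map_sub, map_one, MvPolynomial.eval_X, hσx.2 σ Subset.rfl hσx.1, sub_self]
      · intro τ hne hτ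
        by_contra hτK
        have := hmin τ (mem_filter.2 ⟨mem_cells.2 (mem_of_subset hσx hτ.subset hne), hτK⟩)
        exact absurd (card_lt_card hτ) (by omega)
    · obtain ⟨σ, hσK, hσ⟩ : ∃ σ ∈ K, σ ∉ onesComplex x := by
        by_contra! h
        exact hle fun σ hσ => h σ hσ
      have hσne := (K.isRelLowerSet_faces hσK).1
      rw [mem_onesComplex] at hσ
      push Not at hσ
      obtain ⟨τ, hτ, hne, hxτ⟩ := hσ hσne
      refine prod_eq_zero (i := τ) (mem_cells.2 hne) ?_
      rw [if_pos (mem_of_subset hσK hτ hne), MvPolynomial.eval_X]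
      exact (hx τ).resolve_right hxτ

theorem eval_expectedBetti {x : Finset V → ℤ} (hx : ∀ σ, x σ = 0 ∨ x σ = 1) (k : ℕ) :
    MvPolynomial.eval x (expectedBetti ⊤ k) = betti (onesComplex x) k := by
  classical
  simp only [expectedBetti, map_sum, map_mul, map_natCast, eval_prob hx, mul_ite, mul_one, mul_zero]
  rw [sum_ite_eq', if_pos (by simp)]

theorem monomial_cellExponent (K : PreAbstractSimplicialComplex V) (c : ℤ) :
    MvPolynomial.monomial (cellExponent K) c =
      MvPolynomial.C c * ∏ σ ∈ cells K, MvPolynomial.X σ := by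
  rw [cellExponent, MvPolynomial.monomial_sum_index]
  rfl

open Classical in
theorem eval_monomial_cellExponent {x : Finset V → ℤ} (hx : ∀ σ, x σ = 0 ∨ x σ = 1)
    (K : PreAbstractSimplicialComplex V) (c : ℤ) :
    MvPolynomial.eval x (MvPolynomial.monomial (cellExponent K) c) =
      if K ≤ onesComplex x then c else 0 := by
  rw [monomial_cellExponent, map_mul, map_prod, MvPolynomial.eval_C]
  simp only [MvPolynomial.eval_X]
  split_ifs with h
  · rw [prod_eq_one, mul_one]
    intro σ hσ
    have := h (mem_cells.1 hσ)
    exact this.2 σ Subset.rfl this.1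
  · obtain ⟨σ, hσ, hxσ⟩ : ∃ σ ∈ K, x σ = 0 := by
      by_contra! h'
      refine h fun σ hσ => ⟨(K.isRelLowerSet_faces hσ).1, fun τ hτ hne => ?_⟩
      exact (hx τ).resolve_left (h' τ (mem_of_subset hσ hτ hne))
    rw [prod_eq_zero (mem_cells.2 hσ) hxσ, mul_zero]

/-- Multilinear integer polynomials are determined by their values at `0`-`1` points. -/
theorem eq_of_eval_eq_of_mem_restrictDegree {ι : Type*} [Finite ι] {p q : MvPolynomial ι ℤ}
    (hp : p ∈ MvPolynomial.restrictDegree ι ℤ 1) (hq : q ∈ MvPolynomial.restrictDegree ι ℤ 1)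
    (h : ∀ x : ι → ℤ, (∀ i, x i = 0 ∨ x i = 1) →
      MvPolynomial.eval x p = MvPolynomial.eval x q) : p = q := by
  rw [← sub_eq_zero]
  refine MvPolynomial.eq_zero_of_eval_zero_at_prod_finset _ (fun _ => {0, 1}) (fun i => ?_)
    fun x hx => ?_
  · rw [card_pair zero_ne_one, Nat.lt_succ_iff, MvPolynomial.degreeOf_le_iff]
    intro m hm
    exact (MvPolynomial.mem_restrictDegree ι _ 1).1 (sub_mem hp hq) m hm i
  · rw [map_sub, h x fun i => by simpa using hx i, sub_self]

theorem monomial_mem_restrictDegree {ι : Type*} {m : ι →₀ ℕ} (hm : ∀ i, m i ≤ 1) (c : ℤ) :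
    MvPolynomial.monomial m c ∈ MvPolynomial.restrictDegree ι ℤ 1 := by
  rw [MvPolynomial.mem_restrictDegree]
  intro s hs i
  rw [mem_singleton.1 (MvPolynomial.support_monomial_subset hs)]
  exact hm i

theorem cellExponent_le_one (K : PreAbstractSimplicialComplex V) (σ : Finset V) :
    cellExponent K σ ≤ 1 := by
  classical
  rw [cellExponent_apply]; split_ifs <;> omega

theorem prob_mem_restrictDegree (L K : PreAbstractSimplicialComplex V) :
    prob L K ∈ MvPolynomial.restrictDegree (Finset V) ℤ 1 := by
  classical
  rw [MvPolynomial.mem_restrictDegree]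
  intro s hs τ
  refine (MvPolynomial.degreeOf_le_iff.1 ?_) s hs
  refine (MvPolynomial.degreeOf_prod_le τ _ _).trans ?_
  have hfactor : ∀ σ ∈ cells L, MvPolynomial.degreeOf τ
      (if σ ∈ K then MvPolynomial.X σ
        else if ∀ τ, τ.Nonempty → τ ⊂ σ → τ ∈ K then 1 - MvPolynomial.X σ
        else 1 : MvPolynomial (Finset V) ℤ) ≤ if τ = σ then 1 else 0 := by
    intro σ _
    generalize hd : (if τ = σ then 1 else 0 : ℕ) = d
    have hX : MvPolynomial.degreeOf τ (MvPolynomial.X σ : MvPolynomial (Finset V) ℤ) ≤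
        d := hd ▸ (MvPolynomial.degreeOf_X τ σ).le
    split_ifs with h1 h2
    · exact hX
    · refine (MvPolynomial.degreeOf_sub_le _ _ _).trans ?_
      rw [← map_one MvPolynomial.C, MvPolynomial.degreeOf_C, Nat.zero_max]
      exact hX
    · rw [← map_one MvPolynomial.C, MvPolynomial.degreeOf_C]
      exact Nat.zero_le _
  refine (sum_le_sum hfactor).trans ?_
  rw [sum_ite_eq]
  split_ifs <;> omega

theorem expectedBetti_mem_restrictDegree (L : PreAbstractSimplicialComplex V) (k : ℕ) :
    expectedBetti L k ∈ MvPolynomial.restrictDegree (Finset V) ℤ 1 := by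
  classical
  refine sum_mem fun K _ => ?_
  rw [← nsmul_eq_mul]
  exact nsmul_mem (prob_mem_restrictDegree L K) _

theorem cells_edgeComplex_pair (i j : V) :
    cells (edgeComplex {{i, j}}) = {{i}, {j}, {i, j}} := by
  ext σ
  rw [mem_cells, mem_edgeComplex]
  simp only [mem_singleton, exists_eq_left, mem_insert]
  constructor
  · rintro ⟨hne, h⟩
    rw [← coe_subset, coe_pair, Set.subset_pair_iff_eq] at h
    rcases h with h | h | h | h
    · exact absurd (coe_eq_empty.1 h) hne.ne_empty
    · exact Or.inl (coe_eq_singleton.1 h)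
    · exact Or.inr (Or.inl (coe_eq_singleton.1 h))
    · exact Or.inr (Or.inr (coe_injective (h.trans coe_pair.symm)))
  · rintro (rfl | rfl | rfl) <;> simp

theorem monomial_edge {i j : V} (hij : i ≠ j) :
    MvPolynomial.monomial (cellExponent (edgeComplex {{i, j}})) (1 : ℤ) =
      MvPolynomial.X {i} * MvPolynomial.X {j} * MvPolynomial.X {i, j} := by
  rw [monomial_cellExponent, cells_edgeComplex_pair, prod_insert, prod_insert, prod_singleton,
    map_one, one_mul, mul_assoc]
  · intro h
    have := congrArg card (mem_singleton.1 h)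
    rw [card_singleton, card_pair hij] at this
    omega
  · intro h
    rcases mem_insert.1 h with h | h
    · exact hij (singleton_inj.1 h)
    · have := congrArg card (mem_singleton.1 h)
      rw [card_singleton, card_pair hij] at this
      omega

theorem sum_edges_monomial [LocallyFiniteOrderTop V] :
    ∑ e ∈ edges V, MvPolynomial.monomial (cellExponent (edgeComplex {e})) (1 : ℤ) =
      ∑ i : V, ∑ j ∈ Ioi i, MvPolynomial.X {i} * MvPolynomial.X {j} * MvPolynomial.X {i, j} := by
  rw [sum_sigma']
  symm
  refine sum_bij (fun ij _ => {ij.1, ij.2}) ?_ ?_ ?_ ?_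
  · rintro ⟨i, j⟩ h
    simp only [mem_sigma, mem_univ, true_and, mem_Ioi] at h
    exact pair_mem_edges h.ne
  · rintro ⟨i, j⟩ h ⟨i', j'⟩ h' heq
    simp only [mem_sigma, mem_univ, true_and, mem_Ioi] at h h'
    rcases Sym2.eq_iff.1 (pair_eq_pair_iff.1 heq) with ⟨h1, h2⟩ | ⟨h1, h2⟩
    · simp only at h1 h2
      subst h1 h2
      rfl
    · simp only at h1 h2
      subst h1 h2
      exact absurd h (lt_asymm h')
  · intro e he
    obtain ⟨u, v, huv, rfl⟩ := exists_eq_pair_of_mem_edges he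
    rcases lt_or_gt_of_ne huv with h | h
    · exact ⟨⟨u, v⟩, by simpa using h, rfl⟩
    · exact ⟨⟨v, u⟩, by simpa using h, pair_comm _ _⟩
  · rintro ⟨i, j⟩ h
    simp only [mem_sigma, mem_univ, true_and, mem_Ioi] at h
    rw [monomial_edge h.ne]

theorem singleton_mem_onesComplex {x : Finset V → ℤ} {i : V} :
    {i} ∈ onesComplex x ↔ x {i} = 1 := by
  rw [mem_onesComplex]
  refine ⟨fun h => h.2 _ Subset.rfl (singleton_nonempty i), fun h => ⟨singleton_nonempty i, ?_⟩⟩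
  intro τ hτ hne
  rwa [hne.subset_singleton_iff.1 hτ]

/-- The Euler relation, summed over the random complex. -/
theorem expectedBetti_zero_eq :
    expectedBetti (V := V) ⊤ 0 =
      ∑ i : V, MvPolynomial.X {i}
        - ∑ e ∈ edges V, MvPolynomial.monomial (cellExponent (edgeComplex {e})) (1 : ℤ)
        + ∑ E ∈ (edges V).powerset,
            MvPolynomial.monomial (cellExponent (edgeComplex E)) (cycleCoeff E) := by
  classical
  refine eq_of_eval_eq_of_mem_restrictDegree (expectedBetti_mem_restrictDegree ⊤ 0) ?_ ?_
  · refine add_mem (sub_mem (sum_mem fun i _ => ?_) (sum_mem fun e _ => ?_)) (sum_mem fun E _ => ?_)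
    · refine monomial_mem_restrictDegree (fun σ => ?_) 1
      rw [Finsupp.single_apply]; split_ifs <;> omega
    · exact monomial_mem_restrictDegree (cellExponent_le_one _) _
    · exact monomial_mem_restrictDegree (cellExponent_le_one _) _
  · intro x hx
    have hverts : ∑ i : V, x {i} = #{i : V | {i} ∈ onesComplex x} := by
      rw [card_filter, Nat.cast_sum]
      refine sum_congr rfl fun i _ => ?_
      rcases hx {i} with h | h <;> simp [singleton_mem_onesComplex, h]
    have hedges : ∑ e ∈ edges V, (if edgeComplex {e} ≤ onesComplex x then (1 : ℤ) else 0) =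
        #(edgesOf (onesComplex x)) := by
      rw [← sum_filter, sum_const, nsmul_eq_mul, mul_one]
      congr 2
      ext e
      rw [mem_filter]
      constructor
      · rintro ⟨he, h⟩
        exact singleton_subset_iff.1 ((edgeComplex_le_iff (singleton_subset_iff.2 he)).1 h)
      · intro h
        have he := mem_edges.2 (mem_edgesOf.1 h).2
        exact ⟨he, (edgeComplex_le_iff (singleton_subset_iff.2 he)).2 (singleton_subset_iff.2 h)⟩
    have hsets : ∑ E ∈ (edges V).powerset,
        (if edgeComplex E ≤ onesComplex x then cycleCoeff E else 0) =
        cyclomatic (edgesOf (onesComplex x)) := by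
      rw [← sum_filter, ← sum_powerset_cycleCoeff]
      congr 1
      ext E
      rw [mem_filter, mem_powerset, mem_powerset]
      constructor
      · rintro ⟨hE, h⟩
        exact (edgeComplex_le_iff hE).1 h
      · intro h
        have hE : E ⊆ edges V := h.trans fun e he => mem_edges.2 (mem_edgesOf.1 he).2
        exact ⟨hE, (edgeComplex_le_iff hE).2 h⟩
    rw [eval_expectedBetti hx, map_add, map_sub, map_sum, map_sum, map_sum]
    simp only [eval_monomial_cellExponent hx, MvPolynomial.eval_X]
    rw [hverts, hedges, hsets, betti_zero_eq]

/-! ### The coefficients of edge monomials -/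

theorem cellExponent_edgeComplex_eq_iff {E E' : Finset (Finset V)} (hE : E ⊆ edges V)
    (hE' : E' ⊆ edges V) :
    cellExponent (edgeComplex E) = cellExponent (edgeComplex E') ↔ E = E' := by
  refine ⟨fun h => ?_, fun h => h ▸ rfl⟩
  rw [← edgesOf_edgeComplex hE, cellExponent_injective h, edgesOf_edgeComplex hE']

theorem cellExponent_edgeComplex_ne_single {E : Finset (Finset V)} (hE : E ⊆ edges V) (i : V) :
    Finsupp.single {i} 1 ≠ cellExponent (edgeComplex E) := by
  classical
  intro h
  -- The vertex `i` would have to be covered by an edge of `E`, which is then a further cell.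
  have h1 := DFunLike.congr_fun h {i}
  rw [Finsupp.single_eq_same, cellExponent_apply] at h1
  have hi : {i} ∈ edgeComplex E := by
    by_contra h'; simp [h'] at h1
  obtain ⟨-, e, he, -⟩ := hi
  have h2 := DFunLike.congr_fun h e
  have hcard := mem_edges.1 (hE he)
  have hmem : e ∈ edgeComplex E := ⟨card_pos.1 (by omega), e, he, Subset.rfl⟩
  rw [cellExponent_apply, if_pos hmem, Finsupp.single_apply, if_neg] at h2
  · exact absurd h2 (by omega)
  · rintro rfl
    rw [card_singleton] at hcard
    omega

theorem edgeCoeff_eq_cycleCoeff {E : Finset (Finset V)} (hE : E ⊆ edges V) (h1 : #E ≠ 1) :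
    edgeCoeff E = cycleCoeff E := by
  classical
  rw [edgeCoeff, expectedBetti_zero_eq, MvPolynomial.coeff_add, MvPolynomial.coeff_sub,
    MvPolynomial.coeff_sum, MvPolynomial.coeff_sum, MvPolynomial.coeff_sum,
    sum_eq_zero, sum_eq_zero, sum_eq_single_of_mem E (mem_powerset.2 hE)]
  · rw [MvPolynomial.coeff_monomial, if_pos rfl, sub_zero, zero_add]
  · intro E' hE' hne
    rw [MvPolynomial.coeff_monomial, if_neg]
    rwa [cellExponent_edgeComplex_eq_iff (mem_powerset.1 hE') hE]
  · intro e he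
    rw [MvPolynomial.coeff_monomial, if_neg]
    rw [cellExponent_edgeComplex_eq_iff (singleton_subset_iff.2 he) hE]
    rintro rfl
    exact h1 (card_singleton e)
  · intro i _
    rw [MvPolynomial.coeff_X, if_neg (cellExponent_edgeComplex_ne_single hE i)]

theorem c₁_eq_cycleCoeff {E : Finset (Finset V)} (hE : E ⊆ edges V) : c₁ E = cycleCoeff E := by
  rw [c₁, betti_one_edgeComplex hE]
  split_ifs with h
  · exact (cycleCoeff_eq_zero_of_cyclomatic h).symm
  · refine edgeCoeff_eq_cycleCoeff hE fun h1 => h ?_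
    obtain ⟨e, rfl⟩ := card_eq_one.1 h1
    exact cyclomatic_singleton (singleton_subset_iff.1 hE)

theorem mem_builtEdgeSets {E : Finset (Finset V)} :
    E ∈ builtEdgeSets V ↔ E ⊆ edges V ∧ IsBuiltByIntersectingCycles E := by
  simp [builtEdgeSets]

theorem sum_powerset_edges_monomial :
    ∑ E ∈ (edges V).powerset,
        MvPolynomial.monomial (cellExponent (edgeComplex E)) (cycleCoeff E) =
      ∑ E ∈ builtEdgeSets V, MvPolynomial.monomial (cellExponent (edgeComplex E)) (c₁ E) := by
  symm
  rw [sum_congr rfl fun E hE => by rw [c₁_eq_cycleCoeff (mem_builtEdgeSets.1 hE).1]]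
  refine sum_subset (fun E hE => mem_powerset.2 (mem_builtEdgeSets.1 hE).1) fun E hE hE' => ?_
  have hsub := mem_powerset.1 hE
  have h0 : cycleCoeff E = 0 := by
    by_contra h
    exact hE' (mem_builtEdgeSets.2
      ⟨hsub, isBuiltByIntersectingCycles_of_cycleCoeff_ne_zero hsub h⟩)
  rw [h0, MvPolynomial.monomial_zero]

/-- A set made of two pieces has at least two edges, so its coefficient is the Möbius inverse. -/
theorem edgeCoeff_eq_zero_of_isMadeOfNonIntersectingPieces {E : Finset (Finset V)}
    (hE : E ⊆ edges V) (h : IsMadeOfNonIntersectingPieces E) : edgeCoeff E = 0 := by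
  rw [edgeCoeff_eq_cycleCoeff hE, cycleCoeff_eq_zero_of_isMadeOfNonIntersectingPieces hE h]
  obtain ⟨A, B, hA, hB, hAB, rfl, -⟩ := h
  rw [card_union_of_disjoint hAB]
  have := hA.card_pos
  have := hB.card_pos
  omega

end RandomComplex

theorem mainTheorem1 (n : ℕ) :
    (RandomComplex.expectedBetti (V := Fin n) ⊤ 0 =
      ∑ i : Fin n, MvPolynomial.X {i}
        - ∑ i : Fin n, ∑ j ∈ Finset.Ioi i,
            MvPolynomial.X {i} * MvPolynomial.X {j} * MvPolynomial.X {i, j}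
        + ∑ E ∈ RandomComplex.builtEdgeSets (Fin n),
            MvPolynomial.monomial
              (RandomComplex.cellExponent (RandomComplex.edgeComplex E)) (RandomComplex.c₁ E)) ∧
    (∀ E ∈ RandomComplex.builtEdgeSets (Fin n),
      RandomComplex.edgeCoeff E = RandomComplex.c₁ E) ∧
    (∀ E ⊆ RandomComplex.edges (Fin n),
      ∑ i ∈ Finset.range (E.card + 1), ∑ E' ∈ Finset.powersetCard (E.card - i) E,
          RandomComplex.c₁ E' =
        (RandomComplex.betti (RandomComplex.edgeComplex E) 1 : ℤ)) ∧
    (∀ E ⊆ RandomComplex.edges (Fin n), 2 ≤ E.card →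
      (∃ S, RandomComplex.IsSpike E S) → RandomComplex.edgeCoeff E = 0) ∧
    (∀ E ⊆ RandomComplex.edges (Fin n),
      RandomComplex.IsMadeOfNonIntersectingPieces E → RandomComplex.edgeCoeff E = 0) := by
  refine ⟨?_, fun E hE => ?_, fun E hE => ?_, ?_, ?_⟩
  · rw [RandomComplex.expectedBetti_zero_eq, RandomComplex.sum_edges_monomial,
      RandomComplex.sum_powerset_edges_monomial]
  · obtain ⟨hE, hbuilt⟩ := RandomComplex.mem_builtEdgeSets.1 hE
    have := RandomComplex.two_le_card_of_isBuiltByIntersectingCycles hbuilt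
    rw [RandomComplex.c₁_eq_cycleCoeff hE, RandomComplex.edgeCoeff_eq_cycleCoeff hE (by omega)]
  · rw [RandomComplex.betti_one_edgeComplex hE, ← RandomComplex.sum_powerset_cycleCoeff,
      Finset.sum_powerset, ← Finset.sum_range_reflect]
    refine Finset.sum_congr rfl fun i hi => Finset.sum_congr ?_ fun E' hE' => ?_
    · have := Finset.mem_range.1 hi
      congr 1
      omega
    · exact RandomComplex.c₁_eq_cycleCoeff ((Finset.mem_powersetCard.1 hE').1.trans hE)
  · rintro E hE h2 ⟨S, hS⟩
    exact RandomComplex.edgeCoeff_eq_zero_of_isMadeOfNonIntersectingPieces hE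
      (RandomComplex.isMadeOfNonIntersectingPieces_of_isSpike h2 hS)
  · exact fun E hE h => RandomComplex.edgeCoeff_eq_zero_of_isMadeOfNonIntersectingPieces hE h
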